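/- A unital quantale is a complete lattice $Q$ with a monoid structure whose multiplication distributes over arbitrary joins on both sides; homomorphisms preserve arbitrary joins, products and $1$. A left $Q$-module is a complete lattice $M$ with an action of the monoid $Q$ that distributes over arbitrary joins in both arguments; module morphisms preserve arbitrary joins and scalar multiplication. For a quantale homomorphism $h:Q\to R$ and an $R$-module $N$, let $N_h$ be the $Q$-module on $N$ with $a\cdot x=h(a)\cdot x$. Let $\mathcal{QM}$ be the category whose objects are the pairs $(Q,M)$ with $Q$ a unital quantale and $M$ a left $Q$-module, whose morphisms $(Q,M)\to(R,N)$ are the pairs $(h,f)$ with $h:Q\to R$ a quantale homomorphism and $f:M\to N_h$ a $Q$-module morphism, and whose composition is componentwise. The tensor product $M_1\otimes_Q M_2$ of a right $Q$-module $M_1$ and a left $Q$-module $M_2$ is the quotient of the powerset $\wp(M_1\times M_2)$ by the smallest congruence (equivalence relation compatible with arbitrary joins) that identifies $\{(\bigvee X,y)\}$ with $X\times\{y\}$, $\{(x,\bigvee Y)\}$ with $\{x\}\times Y$, and $\{(x\cdot a,y)\}$ with $\{(x,a\cdot y)\}$, for all $x\in M_1$, $y\in M_2$, $X\subseteq M_1$,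 $Y\subseteq M_2$, $a\in Q$; the class of $\{(x,y)\}$ is written $x\otimes y$. **Theorem.** Let $\{(Q_i,M_i)\}_{i\in I}$ be a family, indexed by a set $I$, of objects of $\mathcal{QM}$. Then its coproduct in $\mathcal{QM}$ exists, and so does the coproduct of the $Q_i$ in the category of unital quantales. Moreover, let $R=\coprod_{i\in I}Q_i$ be any such quantale coproduct, with coproduct injections $\nu_i:Q_i\to R$. Regard $R$ as a right $Q_i$-module by $r\cdot a=r\,\nu_i(a)$, so that $R\otimes_{Q_i}M_i$ is a left $R$-module with $s\cdot(r\otimes x)=(sr)\otimes x$. Then the family $\{R\otimes_{Q_i}M_i\}_{i\in I}$ has a coproduct in the category of left $R$-modules, the injections $\mu_i:R\otimes_{Q_i}M_i\to\coprod_{j\in I}R\otimes_{Q_j}M_j$ of any such coproduct are injective maps, and $$\Bigl(R,\ \coprod_{i\in I}R\otimes_{Q_i}M_i\Bigr)$$ is a coproduct of $\{(Q_i,M_i)\}_{i\in I}$ in $\mathcal{QM}$ with injections $(\nu_i,\ \mu_i\circ(1\otimes\iota_{M_i}))$, where $1\otimes\iota_{M_i}:M_i\to(R\otimes_{Q_i}M_i)_{\nu_i}$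 is the $Q_i$-module morphism $x\mapsto 1\otimes x$. -/

import Mathlib

open CategoryTheory CategoryTheory.Limits

universe u v w

-- Makes `⟶` elaborate through the category structure itself.
attribute [-instance] CategoryTheory.catToReflQuiver

/-! ## Unital quantales -/

/-- A homomorphism of unital quantales: a monoid homomorphism that preserves arbitrary joins. -/
structure QuantaleHom (Q : Type u) (R : Type v) [Monoid Q] [CompleteLattice Q]
    [Monoid R] [CompleteLattice R] extends Q →* R, sSupHom Q R

/-- The objects of the category of unital quantales. -/
structure UQuant : Type (u + 1) where
  carrier : Type u
  [monoid : Monoid carrier]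
  [lattice : CompleteLattice carrier]
  [isQuantale : IsQuantale carrier]

namespace UQuant

instance : CoeSort UQuant.{u} (Type u) := ⟨UQuant.carrier⟩

attribute [instance] UQuant.monoid UQuant.lattice UQuant.isQuantale

end UQuant

namespace QuantaleHom

instance (Q : Type u) (R : Type v) [Monoid Q] [CompleteLattice Q] [Monoid R] [CompleteLattice R] :
    FunLike (QuantaleHom Q R) Q R where
  coe f := f.toFun
  coe_injective f g h := by
    rcases f with ⟨⟨⟨f, _⟩, _⟩, _⟩
    rcases g with ⟨⟨⟨g, _⟩, _⟩, _⟩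
    cases h
    rfl

instance (Q : Type u) (R : Type v) [Monoid Q] [CompleteLattice Q] [Monoid R] [CompleteLattice R] :
    MonoidHomClass (QuantaleHom Q R) Q R where
  map_mul f := f.map_mul'
  map_one f := f.map_one'

instance (Q : Type u) (R : Type v) [Monoid Q] [CompleteLattice Q] [Monoid R] [CompleteLattice R] :
    sSupHomClass (QuantaleHom Q R) Q R where
  map_sSup f := f.map_sSup'

/-- The underlying function of a homomorphism. -/
abbrev fn {Q : Type u} {R : Type v} [Monoid Q] [CompleteLattice Q] [Monoid R] [CompleteLattice R]
    (f : QuantaleHom Q R) : Q → R := f.toFun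

/-- The identity homomorphism. -/
def id (Q : Type u) [Monoid Q] [CompleteLattice Q] : QuantaleHom Q Q where
  toMonoidHom := MonoidHom.id Q
  map_sSup' s := (sSupHom.id Q).map_sSup' s

/-- Composition of homomorphisms, `g` after `f`. -/
def comp {Q : Type u} {R : Type v} {S : Type w} [Monoid Q] [CompleteLattice Q]
    [Monoid R] [CompleteLattice R] [Monoid S] [CompleteLattice S]
    (g : QuantaleHom R S) (f : QuantaleHom Q R) : QuantaleHom Q S where
  toMonoidHom := g.toMonoidHom.comp f.toMonoidHom
  map_sSup' s := (g.tosSupHom.comp f.tosSupHom).map_sSup' s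

end QuantaleHom

/-- The category of unital quantales. -/
instance : LargeCategory UQuant.{u} where
  Hom Q R := QuantaleHom Q R
  id Q := QuantaleHom.id Q
  comp f g := QuantaleHom.comp g f

/-! ## Modules over a quantale -/

/-- A left module over a unital quantale `Q`: a sup-lattice with an action of the monoid `Q` that
distributes over arbitrary joins in both arguments. -/
class IsQuantaleModule (Q : Type u) (M : Type v) [Monoid Q] [CompleteLattice Q]
    [CompleteLattice M] [MulAction Q M] : Prop where
  smul_sSup (a : Q) (X : Set M) : a • sSup X = ⨆ x ∈ X, a • x
  sSup_smul (A : Set Q) (x : M) : sSup A • x = ⨆ a ∈ A, a • x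

/-- A morphism of `Q`-modules: a map that preserves scalar multiplication and arbitrary joins. -/
structure QModHom (Q : Type w) (M : Type u) (N : Type v) [Monoid Q] [CompleteLattice M]
    [MulAction Q M] [CompleteLattice N] [MulAction Q N] extends M →[Q] N, sSupHom M N

namespace QModHom

instance (Q : Type w) (M : Type u) (N : Type v) [Monoid Q] [CompleteLattice M]
    [MulAction Q M] [CompleteLattice N] [MulAction Q N] : FunLike (QModHom Q M N) M N where
  coe f := f.toFun
  coe_injective f g h := by
    rcases f with ⟨⟨f, _⟩, _⟩
    rcases g with ⟨⟨g, _⟩, _⟩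
    cases h
    rfl

variable {Q : Type w} {M : Type u} {N : Type v} [Monoid Q] [CompleteLattice M]
    [MulAction Q M] [CompleteLattice N] [MulAction Q N]

/-- The underlying function of a morphism. -/
abbrev fn (f : QModHom Q M N) : M → N := f.toFun

theorem fn_smul (f : QModHom Q M N) (a : Q) (x : M) : f.fn (a • x) = a • f.fn x :=
  f.map_smul' a x

theorem fn_sSup (f : QModHom Q M N) (X : Set M) : f.fn (sSup X) = sSup (f.fn '' X) :=
  f.map_sSup' X

end QModHom

/-- The objects of the category of left modules over the unital quantale `Q`. -/
structure QModCat (Q : UQuant.{u}) : Type (u + 1) where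
  carrier : Type u
  [lattice : CompleteLattice carrier]
  [mulAction : MulAction Q carrier]
  [isModule : IsQuantaleModule Q carrier]

namespace QModCat

instance (Q : UQuant.{u}) : CoeSort (QModCat Q) (Type u) := ⟨QModCat.carrier⟩

attribute [instance] QModCat.lattice QModCat.mulAction QModCat.isModule

/-- The category of left modules over the unital quantale `Q`. -/
instance (Q : UQuant.{u}) : LargeCategory (QModCat Q) where
  Hom M N := QModHom Q M N
  id M :=
    { toFun := fun x => x
      map_smul' := fun _ _ => rfl
      map_sSup' := (sSupHom.id M).map_sSup' }
  comp f g :=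
    { toFun := fun x => g.toFun (f.toFun x)
      map_smul' := (g.toMulActionHom.comp f.toMulActionHom).map_smul'
      map_sSup' := (g.tosSupHom.comp f.tosSupHom).map_sSup' }

/-- The underlying function of a morphism of `Q`-modules. -/
def fn {Q : UQuant.{u}} {M N : QModCat Q} (f : M ⟶ N) : M → N := QModHom.fn f

theorem fn_smul {Q : UQuant.{u}} {M N : QModCat Q} (f : M ⟶ N) (a : Q) (x : M) :
    fn f (a • x) = a • fn f x := QModHom.fn_smul f a x

theorem fn_sSup {Q : UQuant.{u}} {M N : QModCat Q} (f : M ⟶ N) (X : Set M) :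
    fn f (sSup X) = sSup (fn f '' X) := QModHom.fn_sSup f X

/-- Restriction of scalars along `h : Q ⟶ R`: the `Q`-module `N_h` with the underlying sup-lattice
of the `R`-module `N` and with scalar multiplication `a • x = h a • x`. -/
def restrict {Q R : UQuant.{u}} (h : Q ⟶ R) (N : QModCat R) : QModCat Q :=
  letI : MulAction Q N := MulAction.compHom N (QuantaleHom.toMonoidHom h)
  { carrier := N
    isModule :=
      { smul_sSup := fun a X => IsQuantaleModule.smul_sSup (QuantaleHom.fn h a) X
        sSup_smul := fun A x => by
          change QuantaleHom.fn h (sSup A) • x = ⨆ a ∈ A, QuantaleHom.fn h a • x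
          rw [show QuantaleHom.fn h (sSup A) = sSup (QuantaleHom.fn h '' A) from
            (QuantaleHom.tosSupHom h).map_sSup' A, IsQuantaleModule.sSup_smul, iSup_image] } }

/-- A morphism `M ⟶ N_h` is the same as a join-preserving map `f : M → N` such that
`f (a • x) = h a • f x`. -/
def homRestrict {Q R : UQuant.{u}} (h : Q ⟶ R) {M : QModCat Q} {N : QModCat R} (f : M → N)
    (hsmul : ∀ (a : Q) (x : M), f (a • x) = QuantaleHom.fn h a • f x)
    (hsup : ∀ X : Set M, f (sSup X) = sSup (f '' X)) : M ⟶ restrict h N :=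
  { toFun := f
    map_smul' := hsmul
    map_sSup' := hsup }

/-- The underlying map `M → N` of a morphism `M ⟶ N_h`. -/
def fnRestrict {Q R : UQuant.{u}} {h : Q ⟶ R} {M : QModCat Q} {N : QModCat R}
    (f : M ⟶ restrict h N) : M → N := fn f

theorem fnRestrict_smul {Q R : UQuant.{u}} {h : Q ⟶ R} {M : QModCat Q} {N : QModCat R}
    (f : M ⟶ restrict h N) (a : Q) (x : M) :
    fnRestrict f (a • x) = QuantaleHom.fn h a • fnRestrict f x := fn_smul f a x

theorem fnRestrict_sSup {Q R : UQuant.{u}} {h : Q ⟶ R} {M : QModCat Q} {N : QModCat R}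
    (f : M ⟶ restrict h N) (X : Set M) :
    fnRestrict f (sSup X) = sSup (fnRestrict f '' X) := fn_sSup f X

/-- Restriction of scalars on morphisms: the same underlying map. -/
def restrictMap {Q R : UQuant.{u}} (h : Q ⟶ R) {M N : QModCat R} (f : M ⟶ N) :
    restrict h M ⟶ restrict h N :=
  homRestrict h (M := restrict h M) (fn f) (fun a x => fn_smul f (QuantaleHom.fn h a) x) (fn_sSup f)

end QModCat

/-! ## The category of quantales and their modules -/

/-- A pair `(Q, M)`, where `Q` is a unital quantale and `M` is a left `Q`-module. -/
structure QM : Type (u + 1) where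
  quantale : UQuant.{u}
  module : QModCat quantale

namespace QM

/-- A morphism `(Q, M) ⟶ (R, N)`: a quantale homomorphism `h : Q ⟶ R` and a `Q`-module
homomorphism `f : M ⟶ N_h`. -/
structure Hom (A B : QM.{u}) where
  base : A.quantale ⟶ B.quantale
  map : A.module ⟶ QModCat.restrict base B.module

/-- The identity: a pair of identity maps. -/
def Hom.id (A : QM.{u}) : Hom A A where
  base := 𝟙 A.quantale
  map := QModCat.homRestrict _ (fun x => x) (fun _ _ => rfl) fun X => (congrArg sSup X.image_id).symm

/-- The composition, computed componentwise: `(k, g) ∘ (h, f) = (k ∘ h, g ∘ f)`. -/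
def Hom.comp {A B C : QM.{u}} (F : Hom A B) (G : Hom B C) : Hom A C where
  base := F.base ≫ G.base
  map := QModCat.homRestrict _ (fun x => QModCat.fnRestrict G.map (QModCat.fnRestrict F.map x))
    (fun a x => by rw [QModCat.fnRestrict_smul, QModCat.fnRestrict_smul]; rfl)
    (fun X => by rw [QModCat.fnRestrict_sSup, QModCat.fnRestrict_sSup, Set.image_image])

/-- The category of quantales and their modules. -/
instance : LargeCategory QM.{u} where
  Hom := Hom
  id := Hom.id
  comp := Hom.comp
  id_comp _ := rfl
  comp_id _ := rfl
  assoc _ _ _ := rfl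

end QM

/-! ## Quotients of sup-lattices -/

/-- A congruence of the sup-lattice `L`: an equivalence relation that is compatible with
arbitrary joins, that is, closed under arbitrary joins in `L × L`. -/
structure SupCongr (L : Type u) [CompleteLattice L] extends Setoid L where
  sSup_closed (s : Set (L × L)) (hs : ∀ p ∈ s, r p.1 p.2) :
    r (sSup (Prod.fst '' s)) (sSup (Prod.snd '' s))

namespace SupCongr

variable {L : Type u} [CompleteLattice L]

/-- The congruence generated by a relation `ρ`: the smallest congruence that contains `ρ`. -/
def gen (ρ : L → L → Prop) : SupCongr L where
  r x y := ∀ c : SupCongr L, (∀ a b, ρ a b → c.r a b) → c.r x y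
  iseqv :=
    { refl := fun x c _ => c.refl' x
      symm := fun h c hc => c.symm' (h c hc)
      trans := fun h h' c hc => c.trans' (h c hc) (h' c hc) }
  sSup_closed s hs c hc := c.sSup_closed s fun p hp => hs p hp c hc

/-- The quotient of a sup-lattice by a congruence. -/
def Quo (c : SupCongr L) : Type u := Quotient c.toSetoid

variable (c : SupCongr L)

/-- The class of an element. -/
def cls (x : L) : c.Quo := Quotient.mk c.toSetoid x

/-- The largest element of a class. -/
def rep (q : c.Quo) : L := sSup {x | c.cls x = q}

theorem cls_eq {x y : L} : c.cls x = c.cls y ↔ c.r x y :=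
  ⟨fun h => Quotient.exact (s := c.toSetoid) h, fun h => Quotient.sound (s := c.toSetoid) h⟩

theorem cls_rep (q : c.Quo) : c.cls (c.rep q) = q := by
  obtain ⟨y, rfl⟩ : ∃ y, c.cls y = q := Quotient.exists_rep q
  have h := c.sSup_closed ((fun x => (x, y)) '' {x | c.cls x = c.cls y}) (by
    rintro _ ⟨x, hx, rfl⟩
    exact c.cls_eq.1 hx)
  have h1 : Prod.fst '' ((fun x => (x, y)) '' {x | c.cls x = c.cls y}) = {x | c.cls x = c.cls y} := by
    simp [Set.image_image]
  have h2 : Prod.snd '' ((fun x => (x, y)) '' {x | c.cls x = c.cls y}) = {y} := by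
    rw [Set.image_image]
    exact Set.Nonempty.image_const (s := {x | c.cls x = c.cls y}) ⟨y, rfl⟩ y
  rw [h1, h2, sSup_singleton] at h
  exact c.cls_eq.2 h

theorem le_rep (x : L) : x ≤ c.rep (c.cls x) := le_sSup rfl

theorem sup_congr {x x' y y' : L} (h : c.r x x') (h' : c.r y y') : c.r (x ⊔ y) (x' ⊔ y') := by
  have := c.sSup_closed {(x, x'), (y, y')} (by
    rintro p (rfl | rfl)
    · exact h
    · exact h')
  simpa [Set.image_pair] using this

theorem rep_cls_mono {x y : L} (h : x ≤ y) : c.rep (c.cls x) ≤ c.rep (c.cls y) := by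
  have h1 : c.r (c.rep (c.cls x) ⊔ y) (x ⊔ y) :=
    c.sup_congr (c.cls_eq.1 (c.cls_rep (c.cls x))) (c.refl' y)
  rw [sup_eq_right.2 h] at h1
  exact le_sup_left.trans (le_sSup (c.cls_eq.2 h1))

/-- The quotient order: classes are compared through their largest elements. -/
instance : PartialOrder c.Quo :=
  PartialOrder.lift c.rep fun p q h => by rw [← c.cls_rep p, h, c.cls_rep q]

/-- Taking classes is left adjoint to taking largest elements. -/
def gi : GaloisInsertion c.cls c.rep :=
  GaloisInsertion.monotoneIntro (fun _ _ h => h) (fun _ _ h => c.rep_cls_mono h) c.le_rep c.cls_rep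

/-- The quotient sup-lattice. Its joins are computed on representatives, see `cls_sSup`. -/
instance : CompleteLattice c.Quo := c.gi.liftCompleteLattice

theorem cls_sSup (s : Set L) : c.cls (sSup s) = sSup (c.cls '' s) := by
  rw [sSup_image]
  exact c.gi.gc.l_sSup

/-- The kernel of a join-preserving map, as a congruence. -/
def ker {K : Type v} [CompleteLattice K] (f : sSupHom L K) : SupCongr L where
  r x y := f x = f y
  iseqv := ⟨fun _ => rfl, fun h => h.symm, fun h h' => h.trans h'⟩
  sSup_closed s hs := by
    rw [map_sSup, map_sSup, Set.image_image, Set.image_image]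
    exact congrArg sSup (Set.image_congr fun p hp => hs p hp)

/-- The join-preserving map on `L / gen ρ` induced by a join-preserving map on `L` that identifies
`ρ`-related elements. -/
def lift {K : Type v} [CompleteLattice K] (ρ : L → L → Prop) (f : sSupHom L K)
    (hf : ∀ a b, ρ a b → f a = f b) : sSupHom (gen ρ).Quo K where
  toFun := Quotient.lift f fun _ _ h => h (ker f) hf
  map_sSup' S := by
    have hS : S = (gen ρ).cls '' ((gen ρ).cls ⁻¹' S) :=
      (Set.image_preimage_eq S Quotient.exists_rep).symm
    rw [hS, ← cls_sSup]
    refine (map_sSup f _).trans (congrArg sSup ?_)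
    exact (Set.image_image (Quotient.lift (s := (gen ρ).toSetoid) f
      fun _ _ h => h (ker f) hf) (gen ρ).cls _).symm

theorem sSupHom_ext {K : Type v} [CompleteLattice K] {f g : sSupHom c.Quo K}
    (h : ∀ x, f (c.cls x) = g (c.cls x)) : f = g :=
  DFunLike.ext _ _ fun q => by
    obtain ⟨x, rfl⟩ := Quotient.exists_rep q
    exact h x

end SupCongr

/-! ## The tensor product of quantale modules -/

section Tensor

variable (Q : Type u) (M₁ : Type v) (M₂ : Type w) [Monoid Q] [CompleteLattice M₁]
  [CompleteLattice M₂] [MulAction Qᵐᵒᵖ M₁] [MulAction Q M₂]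

/-- The relation between subsets of `M₁ × M₂` that generates the congruence defining the tensor
product of the right `Q`-module `M₁` and the left `Q`-module `M₂`. Only the joins and the actions of
the two modules enter into it. The right action of `a : Q` on
`M₁` is written `MulOpposite.op a • x`. -/
inductive QTensorRel : Set (M₁ × M₂) → Set (M₁ × M₂) → Prop
  | sSup_left (X : Set M₁) (y : M₂) : QTensorRel {(sSup X, y)} ((fun x => (x, y)) '' X)
  | sSup_right (x : M₁) (Y : Set M₂) : QTensorRel {(x, sSup Y)} ((fun y => (x, y)) '' Y)
  | balanced (a : Q) (x : M₁) (y : M₂) :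
      QTensorRel {(MulOpposite.op a • x, y)} {(x, a • y)}

/-- The tensor product `M₁ ⊗_Q M₂`: the quotient of the free sup-lattice on `M₁ × M₂`, which is the
powerset, by the sup-lattice congruence generated by `QTensorRel`. -/
abbrev QTensor : Type (max v w) := (SupCongr.gen (QTensorRel Q M₁ M₂)).Quo

variable {M₁ M₂}

/-- The pure tensor `x ⊗ y`. -/
def qtmul (x : M₁) (y : M₂) : QTensor Q M₁ M₂ := (SupCongr.gen (QTensorRel Q M₁ M₂)).cls {(x, y)}

theorem qtensor_cls_eq (s : Set (M₁ × M₂)) :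
    (SupCongr.gen (QTensorRel Q M₁ M₂)).cls s = ⨆ p ∈ s, qtmul Q p.1 p.2 := by
  have h : s = sSup ((fun p => {p}) '' s) := by simp
  conv_lhs => rw [h]
  rw [SupCongr.cls_sSup, Set.image_image, sSup_image]
  rfl

variable {Q} in
theorem qtensor_cls_eq_of_rel {s t : Set (M₁ × M₂)} (h : QTensorRel Q M₁ M₂ s t) :
    (SupCongr.gen (QTensorRel Q M₁ M₂)).cls s = (SupCongr.gen (QTensorRel Q M₁ M₂)).cls t :=
  (SupCongr.cls_eq _).2 fun _ hc => hc _ _ h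

theorem sSup_qtmul (X : Set M₁) (y : M₂) : qtmul Q (sSup X) y = ⨆ x ∈ X, qtmul Q x y := by
  rw [qtmul, qtensor_cls_eq_of_rel (.sSup_left X y), qtensor_cls_eq, iSup_image]

theorem qtmul_sSup (x : M₁) (Y : Set M₂) : qtmul Q x (sSup Y) = ⨆ y ∈ Y, qtmul Q x y := by
  rw [qtmul, qtensor_cls_eq_of_rel (.sSup_right x Y), qtensor_cls_eq, iSup_image]

theorem op_smul_qtmul (a : Q) (x : M₁) (y : M₂) :
    qtmul Q (MulOpposite.op a • x) y = qtmul Q x (a • y) :=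
  qtensor_cls_eq_of_rel (.balanced a x y)

theorem qtensor_hom_ext {K : Type*} [CompleteLattice K] {f g : sSupHom (QTensor Q M₁ M₂) K}
    (h : ∀ x y, f (qtmul Q x y) = g (qtmul Q x y)) : f = g := by
  refine SupCongr.sSupHom_ext _ fun s => ?_
  simp only [qtensor_cls_eq, map_iSup, h]

end Tensor

section Bimodule

variable {R : Type*} {Q : Type u} {M₁ : Type v} {M₂ : Type w} [Monoid R] [CompleteLattice R]
  [Monoid Q] [CompleteLattice M₁] [CompleteLattice M₂]
  [MulAction R M₁] [IsQuantaleModule R M₁] [MulAction Qᵐᵒᵖ M₁] [SMulCommClass R Qᵐᵒᵖ M₁]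
  [MulAction Q M₂]

/-- If `M₁` is an `R`-`Q`-bimodule, each `a : R` acts on `M₁ ⊗_Q M₂` by `a • (x ⊗ y) = (a • x) ⊗ y`,
see `smul_qtmul`. -/
def qtensorSMul (a : R) : sSupHom (QTensor Q M₁ M₂) (QTensor Q M₁ M₂) :=
  SupCongr.lift (QTensorRel Q M₁ M₂)
    { toFun := fun s => (SupCongr.gen (QTensorRel Q M₁ M₂)).cls
        ((fun p : M₁ × M₂ => (a • p.1, p.2)) '' s)
      map_sSup' := fun S => by
        rw [Set.sSup_eq_sUnion, Set.sUnion_eq_biUnion, Set.image_iUnion₂]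
        rw [show (⋃ s ∈ S, (fun p : M₁ × M₂ => (a • p.1, p.2)) '' s) =
          sSup ((fun s => (fun p : M₁ × M₂ => (a • p.1, p.2)) '' s) '' S) by
            rw [Set.sSup_eq_sUnion, Set.sUnion_image], SupCongr.cls_sSup, Set.image_image] }
    (by
      intro s t h
      change (SupCongr.gen (QTensorRel Q M₁ M₂)).cls ((fun p : M₁ × M₂ => (a • p.1, p.2)) '' s) =
        (SupCongr.gen (QTensorRel Q M₁ M₂)).cls ((fun p : M₁ × M₂ => (a • p.1, p.2)) '' t)
      rw [qtensor_cls_eq, qtensor_cls_eq, iSup_image, iSup_image]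
      cases h with
      | sSup_left X y =>
        rw [iSup_image, iSup_singleton, IsQuantaleModule.smul_sSup, ← sSup_image, sSup_qtmul,
          iSup_image]
      | sSup_right x Y =>
        rw [iSup_image, iSup_singleton, qtmul_sSup]
      | balanced b x y =>
        rw [iSup_singleton, iSup_singleton, smul_comm, op_smul_qtmul])

theorem qtensorSMul_qtmul (a : R) (x : M₁) (y : M₂) :
    qtensorSMul a (qtmul Q x y) = qtmul Q (a • x) y := by
  change (SupCongr.gen (QTensorRel Q M₁ M₂)).cls
    ((fun p : M₁ × M₂ => (a • p.1, p.2)) '' {(x, y)}) = _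
  rw [Set.image_singleton]
  rfl

/-- The left action of `R` on `M₁ ⊗_Q M₂`. -/
instance : MulAction R (QTensor Q M₁ M₂) where
  smul a t := qtensorSMul a t
  one_smul t := by
    have h : qtensorSMul (1 : R) = sSupHom.id (QTensor Q M₁ M₂) :=
      qtensor_hom_ext Q fun x y => by rw [qtensorSMul_qtmul, one_smul]; rfl
    exact DFunLike.congr_fun h t
  mul_smul a b t := by
    have h : qtensorSMul (a * b) =
        (qtensorSMul a).comp (qtensorSMul b : sSupHom (QTensor Q M₁ M₂) _) :=
      qtensor_hom_ext Q fun x y => by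
        rw [sSupHom.comp_apply, qtensorSMul_qtmul, qtensorSMul_qtmul, qtensorSMul_qtmul, mul_smul]
    exact DFunLike.congr_fun h t

theorem smul_qtmul (a : R) (x : M₁) (y : M₂) : a • qtmul Q x y = qtmul Q (a • x) y :=
  qtensorSMul_qtmul a x y

instance : IsQuantaleModule R (QTensor Q M₁ M₂) where
  smul_sSup a X := by
    rw [← sSup_image]
    exact map_sSup (qtensorSMul a) X
  sSup_smul A t := by
    obtain ⟨s, rfl⟩ := Quotient.exists_rep t
    change qtensorSMul (sSup A) ((SupCongr.gen (QTensorRel Q M₁ M₂)).cls s) =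
      ⨆ a ∈ A, qtensorSMul a ((SupCongr.gen (QTensorRel Q M₁ M₂)).cls s)
    simp only [qtensor_cls_eq, map_iSup, qtensorSMul_qtmul, IsQuantaleModule.sSup_smul]
    rw [iSup₂_comm]
    refine iSup_congr fun p => iSup_congr fun _ => ?_
    rw [← sSup_image, sSup_qtmul, iSup_image]

end Bimodule

/-! ## Extension of scalars -/

/-- The quantale `R` regarded as an `R`-`Q`-bimodule through `h : Q ⟶ R`, with actions
`r • x = r * x` and `x • a = x * h a`. -/
def AsBimodule {Q R : UQuant.{u}} (_h : Q ⟶ R) : Type u := R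

namespace AsBimodule

variable {Q R : UQuant.{u}} (h : Q ⟶ R)

/-- An element of `R`, regarded as an element of the bimodule. -/
def of (r : R) : AsBimodule h := r

/-- An element of the bimodule, regarded as an element of `R`. -/
def val {h : Q ⟶ R} (x : AsBimodule h) : R := x

instance : CompleteLattice (AsBimodule h) := inferInstanceAs (CompleteLattice R)

instance : MulAction R (AsBimodule h) := inferInstanceAs (MulAction R R)

instance : IsQuantaleModule R (AsBimodule h) where
  smul_sSup a X := IsQuantale.mul_sSup_distrib (α := R) a X
  sSup_smul A x := IsQuantale.sSup_mul_distrib (α := R) A x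

instance : MulAction (Q : Type u)ᵐᵒᵖ (AsBimodule h) where
  smul a x := of h (x.val * QuantaleHom.fn h a.unop)
  one_smul x := by
    change x.val * QuantaleHom.toMonoidHom h 1 = x.val
    rw [map_one, mul_one]
  mul_smul a b x := by
    change x.val * QuantaleHom.toMonoidHom h (b.unop * a.unop) =
      x.val * QuantaleHom.toMonoidHom h b.unop * QuantaleHom.toMonoidHom h a.unop
    rw [map_mul, mul_assoc]

instance : SMulCommClass R (Q : Type u)ᵐᵒᵖ (AsBimodule h) where
  smul_comm r a x := (mul_assoc r x.val (QuantaleHom.fn h a.unop)).symm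

end AsBimodule

namespace QModCat

variable {Q R : UQuant.{u}}

/-- Extension of scalars along `h : Q ⟶ R`: the `R`-module `R ⊗_Q M`. -/
def extend (h : Q ⟶ R) (M : QModCat Q) : QModCat R where
  carrier := QTensor Q (AsBimodule h) M

/-- The `Q`-module morphism `1 ⊗ ι_M : M ⟶ (R ⊗_Q M)_h`, `x ↦ 1 ⊗ x`. -/
def extendUnit (h : Q ⟶ R) (M : QModCat Q) : M ⟶ restrict h (extend h M) :=
  homRestrict h (N := extend h M) (fun x => qtmul Q (AsBimodule.of h 1) x)
    (fun a x => by
      change qtmul Q (AsBimodule.of h 1) (a • x) =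
        QuantaleHom.fn h a • qtmul Q (AsBimodule.of h 1) x
      rw [← op_smul_qtmul, smul_qtmul]
      congr 1
      exact (one_mul (QuantaleHom.fn h a)).trans (mul_one (QuantaleHom.fn h a)).symm)
    (fun Y => (qtmul_sSup Q (AsBimodule.of h 1) Y).trans sSup_image.symm)

end QModCat

/-! ## The candidate coproduct -/

/-- Let `F` be the family `(Q i, M i)`, let `c` be a cocone `ν i : Q i ⟶ R` of quantales, and let
`d` be a cocone `μ i : R ⊗_{Q i} M i ⟶ P` of `R`-modules. This is the cocone in `QM` with vertex
`(R, P)` and with components `(ν i, μ i ∘ (1 ⊗ ι_{M i})) : (Q i, M i) ⟶ (R, P)`. -/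
def QM.cofan {I : Type v} (F : I → QM.{u}) (c : Cofan fun i => (F i).quantale)
    (d : Cofan fun i => QModCat.extend (c.inj i) (F i).module) : Cofan F :=
  Cofan.mk (P := (⟨c.pt, d.pt⟩ : QM.{u})) fun i =>
    (⟨c.inj i, QModCat.extendUnit (c.inj i) (F i).module ≫
      QModCat.restrictMap (c.inj i) (d.inj i)⟩ : QM.Hom (F i) ⟨c.pt, d.pt⟩)

/-! A cocone from the family to `(S, N)` consists of homomorphisms `Q i ⟶ S` and module morphisms
from `M i` to `N` along them. The homomorphisms amount to a single `k : R ⟶ S`. Since the scalars of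
`Q i` then act on `N` through `k`, each morphism out of `M i` amounts to an `R`-module morphism `R ⊗
M i ⟶ N_k`, `r ⊗ x ↦ k r • f x` (`extendDesc`, unique by `extend_hom_ext`). These in turn amount to
one `R`-module morphism out of the coproduct of the `R ⊗ M i`. Hence any coproduct of quantales and
any coproduct of the extended modules combine to a coproduct of pairs (`isColimitCofan`), and only
the existence of these two remains.

For quantales, let `W` be the free product of the monoids `Q i`. Homomorphisms from the powerset of
`W` to `T` are monoid homomorphisms `W →* T`, that is, families of monoid homomorphisms `Q i →* T`.
To make the injections preserve joins, the powerset is cut down to the sets of words that respect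
joins taken in one letter. Their closure operator is a nucleus because these sets are stable under
residuals, so the quotient is a quantale; evaluation of words in `T` factors through it because the
words with value below a given `t` form such a set (`isJoinClosed_le`).

For modules, the product is also the coproduct: an element is the join of its components, each
extended by `⊥`. The injections into the product are visibly injective, and this passes to every
other coproduct. -/

/-! ## Quantic nuclei -/

/-- A quantic nucleus: a closure operator `j` on a quantale with `j x * j y ≤ j (x * y)`. -/
structure QuanticNucleus (Q : Type u) [Monoid Q] [CompleteLattice Q] extends
    ClosureOperator Q where
  mul_le' (x y : Q) : toFun x * toFun y ≤ toFun (x * y)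

namespace QuanticNucleus

variable {Q : Type u} [Monoid Q] [CompleteLattice Q] (j : QuanticNucleus Q)

/-- The quotient of a quantale by a quantic nucleus, realized by the closed elements. -/
def Quo : Type u := j.toClosureOperator.Closeds

/-- The closure of an element, as an element of the quotient. -/
def cls (x : Q) : j.Quo := j.toClosureOperator.toCloseds x

/-- The inclusion of the closed elements. -/
def val (a : j.Quo) : Q := Subtype.val a

instance : PartialOrder j.Quo := inferInstanceAs (PartialOrder j.toClosureOperator.Closeds)

/-- Taking closures is left adjoint to the inclusion of the closed elements. -/
def gi : GaloisInsertion j.cls j.val := j.toClosureOperator.gi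

instance : CompleteLattice j.Quo := j.gi.liftCompleteLattice

theorem cls_val (a : j.Quo) : j.cls (j.val a) = a := j.gi.l_u_eq a

theorem cls_sSup (s : Set Q) : j.cls (sSup s) = ⨆ x ∈ s, j.cls x := j.gi.gc.l_sSup

theorem sSup_eq_cls (s : Set j.Quo) : sSup s = j.cls (sSup (j.val '' s)) := by
  rw [cls_sSup, iSup_image, sSup_eq_iSup]
  simp only [cls_val]

instance : Mul j.Quo := ⟨fun a b => j.cls (j.val a * j.val b)⟩

instance : One j.Quo := ⟨j.cls 1⟩

variable [IsQuantale Q]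

/-- One inequality is monotonicity of the product, the other is the defining inequality of a
nucleus. Through this identity the monoid laws and distributivity descend from `Q` to the quotient.
-/
theorem cls_mul (x y : Q) : j.cls (x * y) = j.cls x * j.cls y := by
  apply le_antisymm
  · exact j.gi.gc.monotone_l (mul_le_mul' (j.gi.gc.le_u_l x) (j.gi.gc.le_u_l y))
  · exact j.gi.gc.l_le (j.mul_le' x y)

instance : Monoid j.Quo where
  mul_assoc a b c := by
    rw [← j.cls_val a, ← j.cls_val b, ← j.cls_val c]
    simp only [← cls_mul, mul_assoc]
  one_mul a := by
    rw [← j.cls_val a]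
    exact (j.cls_mul 1 _).symm.trans (by rw [one_mul])
  mul_one a := by
    rw [← j.cls_val a]
    exact (j.cls_mul _ 1).symm.trans (by rw [mul_one])

instance : IsQuantale j.Quo where
  mul_sSup_distrib a s := by
    rw [sSup_eq_cls, ← j.cls_val a, ← cls_mul, mul_sSup_distrib, iSup_image, j.gi.gc.l_iSup₂]
    simp only [cls_mul, cls_val]
  sSup_mul_distrib s a := by
    rw [sSup_eq_cls, ← j.cls_val a, ← cls_mul, sSup_mul_distrib, iSup_image, j.gi.gc.l_iSup₂]
    simp only [cls_mul, cls_val]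

end QuanticNucleus

theorem mul_biSup_distrib {Q : Type*} [Monoid Q] [CompleteLattice Q] [IsQuantale Q] {ι : Type*}
    (a : Q) (s : Set ι) (f : ι → Q) : a * ⨆ i ∈ s, f i = ⨆ i ∈ s, a * f i := by
  rw [← sSup_image, mul_sSup_distrib, iSup_image]

theorem biSup_mul_distrib {Q : Type*} [Monoid Q] [CompleteLattice Q] [IsQuantale Q] {ι : Type*}
    (s : Set ι) (f : ι → Q) (a : Q) : (⨆ i ∈ s, f i) * a = ⨆ i ∈ s, f i * a := by
  rw [← sSup_image, sSup_mul_distrib, iSup_image]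

/-! ## Coproducts of unital quantales -/

section QuantaleCoproduct

open scoped Pointwise

theorem sSup_mul_sSup {Q : Type*} [Monoid Q] [CompleteLattice Q] [IsQuantale Q] (s t : Set Q) :
    sSup (s * t) = sSup s * sSup t := by
  simp only [sSup_mul_distrib, mul_sSup_distrib, ← Set.image2_mul, sSup_image2]
  exact iSup₂_comm _

/-- The powerset of a monoid is a quantale. -/
instance Set.isQuantale (W : Type u) [Monoid W] : IsQuantale (Set W) where
  mul_sSup_distrib s S := Set.mul_sUnion s S
  sSup_mul_distrib S s := Set.sUnion_mul S s

/-! ### Join-closed sets of words -/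

variable {I : Type u} (Q : I → UQuant.{u})

/-- The free product of the monoids `Q i`. -/
abbrev Words : Type u := Monoid.CoprodI fun i => (Q i : Type u)

/-- The words with one letter. -/
def letter (i : I) : Q i →* Words Q :=
  Monoid.CoprodI.of (M := fun i => (Q i : Type u))

/-- A subset of the free product of the monoids `Q i` is join-closed if it respects all joins that
are taken in one letter of a word. -/
def IsJoinClosed (S : Set (Words Q)) : Prop :=
  ∀ (i : I) (u v : Words Q) (X : Set (Q i)),
    u * letter Q i (sSup X) * v ∈ S ↔ ∀ x ∈ X, u * letter Q i x * v ∈ S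

variable {Q}

/-- The condition is tested in all contexts `u`, `v`, so `b` can be absorbed into the right context.
Stability under both residuals is what turns the closure operator into a nucleus. -/
theorem IsJoinClosed.left_residual {S : Set (Words Q)} (hS : IsJoinClosed Q S)
    (b : Words Q) : IsJoinClosed Q {w | w * b ∈ S} := fun i u v X => by
  simpa only [Set.mem_ofPred_eq, mul_assoc] using hS i u (v * b) X

theorem IsJoinClosed.right_residual {S : Set (Words Q)} (hS : IsJoinClosed Q S)
    (a : Words Q) : IsJoinClosed Q {w | a * w ∈ S} := fun i u v X => by
  simpa only [Set.mem_ofPred_eq, mul_assoc] using hS i (a * u) v X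

variable (Q)

/-- The closure operator of the join-closed subsets. -/
def joinClosure : ClosureOperator (Set (Words Q)) :=
  ClosureOperator.ofCompletePred (IsJoinClosed Q) fun 𝒮 h𝒮 i u v X => by
    simp only [Set.sInf_eq_sInter, Set.mem_sInter]
    exact ⟨fun h x hx S hS => (h𝒮 S hS i u v X).1 (h S hS) x hx,
      fun h S hS => (h𝒮 S hS i u v X).2 fun x hx => h x hx S hS⟩

theorem isJoinClosed_joinClosure (S : Set (Words Q)) :
    IsJoinClosed Q (joinClosure Q S) := (joinClosure Q).isClosed_closure S

variable {Q} in
theorem joinClosure_subset {S T : Set (Words Q)} (h : S ⊆ T)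
    (hT : IsJoinClosed Q T) : joinClosure Q S ⊆ T :=
  ClosureOperator.closure_min (c := joinClosure Q) h hT

/-- The nucleus of the join-closed subsets. -/
def joinNucleus : QuanticNucleus (Set (Words Q)) where
  toClosureOperator := joinClosure Q
  mul_le' A B := by
    have hAB := isJoinClosed_joinClosure Q (A * B)
    rintro _ ⟨a, ha, b, hb, rfl⟩
    -- The two factors are handled one at a time: with `a` fixed in the closure of `A`, it suffices
    -- to take `b` in `B` itself; then, with this `b` fixed, it suffices to take `a` in `A`.
    refine joinClosure_subset (fun b hb => ?_) (hAB.right_residual a) hb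
    exact joinClosure_subset
      (T := {w | w * b ∈ joinClosure Q (A * B)})
      (fun a ha => (joinClosure Q).le_closure (A * B) (Set.mul_mem_mul ha hb))
      (hAB.left_residual b) ha

/-- The coproduct of a family of unital quantales. -/
def quantaleCoprod : UQuant.{u} where
  carrier := (joinNucleus Q).Quo

/-- The closures of single words. -/
def quantaleCoprodWord : Words Q →* quantaleCoprod Q where
  toFun w := (joinNucleus Q).cls {w}
  map_one' := rfl
  map_mul' v w := by rw [← Set.singleton_mul_singleton, QuanticNucleus.cls_mul]; rfl

/-- Elements of the coproduct are join-closed sets, so comparison with a word is membership. -/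
theorem quantaleCoprodWord_le {w : Words Q} {a : quantaleCoprod Q} :
    quantaleCoprodWord Q w ≤ a ↔ w ∈ (joinNucleus Q).val a :=
  ((joinNucleus Q).gi.gc _ _).trans Set.singleton_subset_iff

theorem cls_eq_iSup_word (S : Set (Words Q)) :
    ((joinNucleus Q).cls S : quantaleCoprod Q) = ⨆ w ∈ S, quantaleCoprodWord Q w := by
  conv_lhs => rw [← Set.biUnion_of_singleton S]
  exact (joinNucleus Q).gi.gc.l_iSup₂

/-- The coproduct injections. -/
def quantaleCoprodInj (i : I) : Q i ⟶ quantaleCoprod Q where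
  toMonoidHom := (quantaleCoprodWord Q).comp (letter Q i)
  map_sSup' X := by
    change quantaleCoprodWord Q (letter Q i (sSup X)) =
      sSup ((fun x => quantaleCoprodWord Q (letter Q i x)) '' X)
    -- Both sides are compared through their upper bounds `a`. As `a` is a join-closed set, its
    -- defining condition with empty contexts `u = v = 1` is exactly the required equivalence.
    refine eq_of_forall_ge_iff fun a => ?_
    have h : IsJoinClosed Q ((joinNucleus Q).val a) := a.2
    have := h i 1 1 X
    simp only [one_mul, mul_one] at this
    rw [quantaleCoprodWord_le, this, sSup_le_iff, Set.forall_mem_image]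
    simp only [quantaleCoprodWord_le]

/-! ### The universal property of the quantale coproduct -/

variable {Q} {T : UQuant.{u}}

/-- The homomorphism on words induced by a family of homomorphisms. -/
def evalWord (g : ∀ i, Q i ⟶ T) : Words Q →* T :=
  Monoid.CoprodI.lift fun i => QuantaleHom.toMonoidHom (g i)

theorem evalWord_letter (g : ∀ i, Q i ⟶ T) (i : I) (x : Q i) :
    evalWord g (letter Q i x) = QuantaleHom.toMonoidHom (g i) x :=
  Monoid.CoprodI.lift_of (M := fun i => (Q i : Type u)) _ x

/-- Each `g i` preserves joins and multiplication in `T` distributes over them, so a join in one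
letter becomes a join of the values of whole words, which lies below `t` exactly when every term
does. -/
theorem isJoinClosed_le (g : ∀ i, Q i ⟶ T) (t : T) :
    IsJoinClosed Q {w | evalWord g w ≤ t} := by
  intro i u v X
  have h : QuantaleHom.toMonoidHom (g i) (sSup X) =
      ⨆ x ∈ X, QuantaleHom.toMonoidHom (g i) x :=
    ((QuantaleHom.tosSupHom (g i)).map_sSup' X).trans sSup_image
  simp only [Set.mem_ofPred_eq, map_mul, evalWord_letter, h, mul_biSup_distrib, biSup_mul_distrib, iSup_le_iff]

/-- The join of the values of the words in a subset. -/
def evalSet (g : ∀ i, Q i ⟶ T) (S : Set (Words Q)) : T :=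
  ⨆ w ∈ S, evalWord g w

theorem evalSet_le {g : ∀ i, Q i ⟶ T} {S : Set (Words Q)} {t : T} :
    evalSet g S ≤ t ↔
      S ⊆ {w | evalWord g w ≤ t} :=
  iSup₂_le_iff

/-- Evaluation does not see the closure: a bound `t` for the words of `S` bounds its closure too,
since the words with value below `t` form a join-closed set. As the operations of the quotient are
closures of those on sets, the induced map is a homomorphism. -/
theorem evalSet_val_cls (g : ∀ i, Q i ⟶ T) (S : Set (Words Q)) :
    evalSet g ((joinNucleus Q).val ((joinNucleus Q).cls S)) = evalSet g S := by
  refine eq_of_forall_ge_iff fun t => ?_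
  rw [evalSet_le, evalSet_le]
  exact ⟨((joinClosure Q).le_closure S).trans, fun h => joinClosure_subset h (isJoinClosed_le g t)⟩

theorem evalSet_singleton (g : ∀ i, Q i ⟶ T) (w : Words Q) :
    evalSet g {w} = evalWord g w :=
  iSup_singleton

theorem evalSet_mul (g : ∀ i, Q i ⟶ T) (A B : Set (Words Q)) :
    evalSet g (A * B) = evalSet g A * evalSet g B := by
  simp only [evalSet, ← sSup_image, Set.image_mul, sSup_mul_sSup]

theorem evalSet_sSup (g : ∀ i, Q i ⟶ T) (𝒮 : Set (Set (Words Q))) :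
    evalSet g (sSup 𝒮) = ⨆ S ∈ 𝒮, evalSet g S := iSup_sUnion _ _

/-- The homomorphism on the coproduct induced by a family of homomorphisms. -/
def quantaleCoprodDesc (g : ∀ i, Q i ⟶ T) : quantaleCoprod Q ⟶ T where
  toFun a := evalSet g ((joinNucleus Q).val a)
  map_one' := (evalSet_val_cls g 1).trans ((evalSet_singleton g 1).trans (map_one _))
  map_mul' a b := (evalSet_val_cls g _).trans (evalSet_mul g _ _)
  map_sSup' s := by
    refine (congrArg (fun a => evalSet g ((joinNucleus Q).val a))
      (QuanticNucleus.sSup_eq_cls _ s)).trans ?_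
    refine (evalSet_val_cls g _).trans ((evalSet_sSup g _).trans ?_)
    exact iSup_image.trans sSup_image.symm

/-- Every element is a join of words, and words are products of letters. -/
theorem quantaleCoprod_hom_ext {f g : quantaleCoprod Q ⟶ T}
    (h : ∀ i, quantaleCoprodInj Q i ≫ f = quantaleCoprodInj Q i ≫ g) : f = g := by
  have hw : (QuantaleHom.toMonoidHom f).comp (quantaleCoprodWord Q) =
      (QuantaleHom.toMonoidHom g).comp (quantaleCoprodWord Q) :=
    Monoid.CoprodI.ext_hom (M := fun i => (Q i : Type u)) _ _ fun i => congrArg QuantaleHom.toMonoidHom (h i)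
  refine DFunLike.ext (F := QuantaleHom _ _) f g fun a => ?_
  rw [← (joinNucleus Q).cls_val a, cls_eq_iSup_word]
  refine (map_iSup₂ (QuantaleHom.tosSupHom f) _).trans
    (Eq.trans ?_ (map_iSup₂ (QuantaleHom.tosSupHom g) _).symm)
  exact iSup_congr fun w => iSup_congr fun _ => DFunLike.congr_fun hw w

variable (Q)

theorem UQuant.hasCoproduct : HasCoproduct Q :=
  HasColimit.mk ⟨Cofan.mk (quantaleCoprod Q) (quantaleCoprodInj Q),
    Cofan.IsColimit.mk _ (fun t => quantaleCoprodDesc t.inj)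
      (fun t i => DFunLike.ext (F := QuantaleHom _ _) _ _ fun x =>
        (evalSet_val_cls t.inj _).trans
          ((evalSet_singleton t.inj _).trans (evalWord_letter _ i x)))
      (fun t _ hm => quantaleCoprod_hom_ext fun i => (hm i).trans
        (DFunLike.ext (F := QuantaleHom _ _) _ _ fun x =>
        (evalSet_val_cls t.inj _).trans
          ((evalSet_singleton t.inj _).trans (evalWord_letter _ i x))).symm)⟩

end QuantaleCoproduct

/-! ## Coproducts of modules -/

namespace QModCat

variable {R : UQuant.{u}}

theorem hom_ext {M N : QModCat R} {f g : M ⟶ N} (h : ∀ x, fn f x = fn g x) : f = g :=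
  DFunLike.ext (F := QModHom R M N) f g h

theorem fn_iSup {M N : QModCat R} (f : M ⟶ N) {ι : Sort*} (x : ι → M) :
    fn f (⨆ i, x i) = ⨆ i, fn f (x i) := map_iSup (QModHom.tosSupHom f) x

theorem fn_bot {M N : QModCat R} (f : M ⟶ N) : fn f ⊥ = ⊥ := map_bot (QModHom.tosSupHom f)

theorem smul_iSup {M : QModCat R} (a : R) {ι : Sort*} (x : ι → M) :
    a • (⨆ i, x i) = ⨆ i, a • x i := by
  rw [iSup, IsQuantaleModule.smul_sSup, iSup_range]

theorem smul_bot {M : QModCat R} (a : R) : a • (⊥ : M) = ⊥ := by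
  rw [← sSup_empty, IsQuantaleModule.smul_sSup, iSup_emptyset, sSup_empty]

variable {I : Type u} (N : I → QModCat R)

/-- The product of a family of modules, which is also its coproduct. -/
def pi : QModCat R where
  carrier := ∀ i, N i
  isModule :=
    { smul_sSup := fun a X => funext fun i => by
        simp only [Pi.smul_apply, sSup_apply, iSup_apply, smul_iSup, iSup_subtype]
      sSup_smul := fun A x => funext fun i => by
        simp only [Pi.smul_apply, iSup_apply, IsQuantaleModule.sSup_smul] }

open Classical in
/-- The injections of a family of modules into its product. -/
noncomputable def piInj (i : I) : N i ⟶ pi N where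
  toFun x := (Function.update ⊥ i x : ∀ i, N i)
  map_smul' a x := funext fun k => by
    change Function.update (⊥ : ∀ i, N i) i (a • x) k = a • Function.update (⊥ : ∀ i, N i) i x k
    obtain rfl | hk := eq_or_ne k i
    · simp only [Function.update_self]
    · simp only [Function.update_of_ne hk, Pi.bot_apply, smul_bot]
  map_sSup' X := funext fun k => by
    change Function.update (⊥ : ∀ i, N i) i (sSup X) k =
      (sSup ((fun x => (Function.update ⊥ i x : ∀ i, N i)) '' X) : ∀ i, N i) k
    rw [sSup_image, iSup_apply]
    simp only [iSup_apply]
    obtain rfl | hk := eq_or_ne k i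
    · simp only [Function.update_self, sSup_eq_iSup]
    · simp only [Function.update_of_ne hk, Pi.bot_apply, iSup_bot]

theorem piInj_same (i : I) (x : N i) : (fn (piInj N i) x : ∀ i, N i) i = x :=
  by classical exact Function.update_self (β := fun i => (N i : Type u)) i x _

theorem piInj_of_ne {i k : I} (hk : k ≠ i) (x : N i) : (fn (piInj N i) x : ∀ i, N i) k = ⊥ := by
  classical exact Function.update_of_ne (β := fun i => (N i : Type u)) hk x _

theorem piInj_injective (i : I) : Function.Injective (fn (piInj N i)) := fun x y h => by
  rw [← piInj_same N i x, h, piInj_same]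

/-- In component `k` every term with `i ≠ k` is `⊥` and drops out of the join. This decomposition
makes morphisms out of the product determined by their restrictions to the factors. -/
theorem eq_iSup_piInj (x : pi N) : x = ⨆ i, fn (piInj N i) ((x : ∀ i, N i) i) := by
  refine funext fun k => ?_
  refine Eq.trans ?_ (iSup_apply (f := fun i => (fn (piInj N i) ((x : ∀ i, N i) i) : ∀ i, N i))).symm
  refine le_antisymm ?_ (iSup_le fun i => ?_)
  · exact (piInj_same N k _).ge.trans
      (le_iSup (fun i => (fn (piInj N i) ((x : ∀ i, N i) i) : ∀ i, N i) k) k)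
  · obtain rfl | hk := eq_or_ne k i
    · exact (piInj_same N k _).le
    · exact (piInj_of_ne N hk _).le.trans bot_le

/-! ### The product of modules as a coproduct -/

variable {N} {P : QModCat R}

theorem iSup_fn_sSup (f : ∀ i, N i ⟶ P) (X : Set (∀ i, N i)) :
    ⨆ i, fn (f i) ((sSup X) i) = sSup ((fun x : ∀ i, N i => ⨆ i, fn (f i) (x i)) '' X) := by
  simp only [sSup_image, sSup_apply, fn_iSup, iSup_subtype]
  rw [iSup_comm]
  exact iSup_congr fun x => iSup_comm

/-- The morphism on the coproduct induced by a family of morphisms. -/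
def piDesc (f : ∀ i, N i ⟶ P) : pi N ⟶ P where
  toFun x := ⨆ i, fn (f i) ((x : ∀ i, N i) i)
  map_smul' a x := by
    refine Eq.trans ?_ (smul_iSup a _).symm
    exact iSup_congr fun i => fn_smul (f i) a _
  map_sSup' X := iSup_fn_sSup f X

theorem piInj_desc (f : ∀ i, N i ⟶ P) (i : I) : piInj N i ≫ piDesc f = f i := by
  refine hom_ext fun x => ?_
  change ⨆ k, fn (f k) ((fn (piInj N i) x : ∀ i, N i) k) = fn (f i) x
  refine le_antisymm (iSup_le fun k => ?_) ?_
  · obtain rfl | hk := eq_or_ne k i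
    · rw [piInj_same]
    · rw [piInj_of_ne N hk, fn_bot]
      exact bot_le
  · exact (congrArg (fn (f i)) (piInj_same N i x)).ge.trans
      (le_iSup (fun k => fn (f k) ((fn (piInj N i) x : ∀ i, N i) k)) i)

theorem pi_hom_ext {f g : pi N ⟶ P} (h : ∀ i, piInj N i ≫ f = piInj N i ≫ g) : f = g := by
  refine hom_ext fun x => ?_
  rw [eq_iSup_piInj N x, fn_iSup, fn_iSup]
  exact iSup_congr fun i => congrArg (fun φ => fn φ ((x : ∀ i, N i) i)) (h i)

variable (N) in
theorem hasCoproduct : HasCoproduct N :=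
  HasColimit.mk ⟨Cofan.mk (pi N) (piInj N),
    Cofan.IsColimit.mk _ (fun t => piDesc t.inj) (fun t => piInj_desc t.inj)
      fun t _ hm => pi_hom_ext fun i => (hm i).trans (piInj_desc t.inj i).symm⟩

/-- The injection into the product factors through `d.inj i`, by the universal property of `d`.
Since the composite is injective, so is `d.inj i`. -/
theorem inj_injective {d : Cofan N} (hd : IsColimit d) (i : I) :
    Function.Injective (fn (d.inj i)) := fun x y h => by
  refine piInj_injective N i ?_
  rw [← Cofan.IsColimit.fac hd (piInj N) i]
  exact congrArg (fn (Cofan.IsColimit.desc hd (piInj N))) h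

/-! ## The universal property of the extension of scalars -/

variable {Q S : UQuant.{u}} {h : Q ⟶ R} {M : QModCat Q}

/-- Let `h : Q ⟶ R` and `k : R ⟶ S` be homomorphisms of quantales and `N` an `S`-module. A map
`f : M → N` that is a module morphism along `k ∘ h` induces the module morphism
`r ⊗ x ↦ k r • f x` along `k`. -/
def extendDesc {N : QModCat S} (k : R ⟶ S) {l : Q ⟶ S} (hl : h ≫ k = l)
    (f : M ⟶ restrict l N) : extend h M ⟶ restrict k N :=
  let φ : sSupHom (QTensor Q (AsBimodule h) M) N := SupCongr.lift (QTensorRel Q (AsBimodule h) M)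
    { toFun := fun s => ⨆ p ∈ s, QuantaleHom.fn k p.1.val • fnRestrict f p.2
      map_sSup' := fun 𝒮 => (iSup_sUnion _ _).trans sSup_image.symm }
    (by
      intro s t hst
      change (⨆ p ∈ s, QuantaleHom.fn k p.1.val • fnRestrict f p.2) =
        ⨆ p ∈ t, QuantaleHom.fn k p.1.val • fnRestrict f p.2
      cases hst with
      | sSup_left X y =>
        rw [iSup_singleton, iSup_image]
        -- Joins in the first factor are joins of scalars in `R`, and these distribute over the
        -- action on `N_k`.
        exact IsQuantaleModule.sSup_smul (Q := R) (M := restrict k N) X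
          (show restrict k N from fnRestrict (h := l) (N := N) f y)
      | sSup_right x Y =>
        rw [iSup_singleton, iSup_image, fnRestrict_sSup, IsQuantaleModule.smul_sSup, iSup_image]
      | balanced a x y =>
        rw [iSup_singleton, iSup_singleton, fnRestrict_smul, ← mul_smul]
        congr 1
        -- With `l` replaced by `h ≫ k`, the scalar `a` acts on `N` as `k (h a)`, and what remains
        -- is multiplicativity of `k` on `x * h a`.
        subst hl
        exact (QuantaleHom.toMonoidHom k).map_mul x.val (QuantaleHom.fn h a))
  have hφ : ∀ r x, φ (qtmul Q r x) = QuantaleHom.fn k r.val • fnRestrict f x := fun _ _ =>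
    iSup_singleton
  homRestrict k (M := extend h M) φ
    (fun a t => by
      obtain ⟨s, rfl⟩ := Quotient.exists_rep t
      change φ (qtensorSMul a ((SupCongr.gen (QTensorRel Q (AsBimodule h) M)).cls s)) =
        QuantaleHom.fn k a • φ ((SupCongr.gen (QTensorRel Q (AsBimodule h) M)).cls s)
      simp only [qtensor_cls_eq, map_iSup, qtensorSMul_qtmul, hφ, smul_iSup]
      refine iSup_congr fun p => iSup_congr fun _ => ?_
      rw [← mul_smul]
      congr 1
      exact (QuantaleHom.toMonoidHom k).map_mul a p.1.val)
    φ.map_sSup'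

theorem extendDesc_unit {N : QModCat S} (k : R ⟶ S) {l : Q ⟶ S} (hl : h ≫ k = l)
    (f : M ⟶ restrict l N) (x : M) :
    fnRestrict (extendDesc k hl f) (fnRestrict (extendUnit h M) x) = fnRestrict f x := by
  refine Eq.trans (b := QuantaleHom.fn k 1 • fnRestrict f x) iSup_singleton ?_
  rw [show QuantaleHom.fn k 1 = 1 from (QuantaleHom.toMonoidHom k).map_one, one_smul]

/-- Since `r ⊗ x = r • (1 ⊗ x)`, the elements `1 ⊗ x` generate the tensor product as an `R`-module.
-/
theorem extend_hom_ext {N : QModCat R} {f g : extend h M ⟶ N}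
    (hfg : ∀ x, fn f (fnRestrict (extendUnit h M) x) = fn g (fnRestrict (extendUnit h M) x)) :
    f = g := by
  have key : QModHom.tosSupHom f = QModHom.tosSupHom g := by
    refine qtensor_hom_ext Q fun (r : AsBimodule h) (x : M) => ?_
    have hr' : r = r.val • AsBimodule.of h 1 := (mul_one r.val).symm
    have hr : qtmul Q r x = r.val • (fnRestrict (extendUnit h M) x : extend h M) :=
      (congrArg (fun r => qtmul Q r x) hr').trans (smul_qtmul r.val (AsBimodule.of h 1) x).symm
    rw [hr]
    exact (fn_smul f _ _).trans ((congrArg (r.val • ·) (hfg x)).trans (fn_smul g _ _).symm)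
  exact hom_ext fun t => DFunLike.congr_fun key t

end QModCat

/-! ## Coproducts of pairs -/

namespace QM

/-- The type of the second component depends on the first, so second components are compared as
plain maps into `B.module`. -/
theorem hom_ext {A B : QM.{u}} {f g : A ⟶ B} (hb : Hom.base f = Hom.base g)
    (hm : ∀ x, QModCat.fnRestrict (Hom.map f) x = QModCat.fnRestrict (Hom.map g) x) : f = g := by
  obtain ⟨f, φ⟩ := f
  obtain ⟨g, ψ⟩ := g
  obtain rfl : f = g := hb
  exact congrArg (Hom.mk f) (QModCat.hom_ext hm)

variable {I : Type u} {F : I → QM.{u}} {c : Cofan fun i => (F i).quantale}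
  {d : Cofan fun i => QModCat.extend (c.inj i) (F i).module}

/-- The morphism out of `QM.cofan` induced by a cofan. -/
noncomputable def cofanDesc (hc : IsColimit c) (hd : IsColimit d) (s : Cofan F) :
    (cofan F c d).pt ⟶ s.pt :=
  (⟨Cofan.IsColimit.desc hc fun i => Hom.base (s.inj i),
    -- The target is the module of `s.pt` restricted along the first component. It is an `R`-module,
    -- so the universal property of `d` applies.
    Cofan.IsColimit.desc hd fun i => QModCat.extendDesc _
      (Cofan.IsColimit.fac hc (fun i => Hom.base (s.inj i)) i) (Hom.map (s.inj i))⟩ :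
    Hom ⟨c.pt, d.pt⟩ s.pt)

theorem cofan_inj_desc (hc : IsColimit c) (hd : IsColimit d) (s : Cofan F) (i : I) :
    (cofan F c d).inj i ≫ cofanDesc hc hd s = s.inj i := by
  refine hom_ext (Cofan.IsColimit.fac hc (fun i => Hom.base (s.inj i)) i) fun x => ?_
  refine Eq.trans ?_ (QModCat.extendDesc_unit _
    (Cofan.IsColimit.fac hc (fun i => Hom.base (s.inj i)) i) (Hom.map (s.inj i)) x)
  exact congrArg (fun φ => QModCat.fn φ
    (QModCat.fnRestrict (QModCat.extendUnit (c.inj i) (F i).module) x))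
    (Cofan.IsColimit.fac hd (fun i => QModCat.extendDesc _
      (Cofan.IsColimit.fac hc (fun i => Hom.base (s.inj i)) i) (Hom.map (s.inj i))) i)

theorem cofan_hom_ext (hc : IsColimit c) (hd : IsColimit d) {A : QM.{u}}
    {f g : (⟨c.pt, d.pt⟩ : QM.{u}) ⟶ A}
    (h : ∀ i, (cofan F c d).inj i ≫ f = (cofan F c d).inj i ≫ g) : f = g := by
  obtain ⟨f, φ⟩ := f
  obtain ⟨g, ψ⟩ := g
  obtain rfl : f = g := Cofan.IsColimit.hom_ext hc _ _ fun i => congrArg Hom.base (h i)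
  congr 1
  -- Once the base homomorphisms agree, `φ` and `ψ` are parallel `R`-module morphisms. It suffices
  -- to compare them on the images of the elements `1 ⊗ x`, where the second component of `h i`
  -- gives the equality.
  refine Cofan.IsColimit.hom_ext hd _ _ fun i => QModCat.extend_hom_ext fun x => ?_
  exact congrArg (fun m : F i ⟶ A => QModCat.fnRestrict (Hom.map m) x) (h i)

/-- `QM.cofan` is a coproduct if both of its components are. -/
noncomputable def isColimitCofan (hc : IsColimit c) (hd : IsColimit d) :
    IsColimit (cofan F c d) :=
  Cofan.IsColimit.mk _ (cofanDesc hc hd) (cofan_inj_desc hc hd) fun s _ hm =>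
    cofan_hom_ext hc hd fun i => (hm i).trans (cofan_inj_desc hc hd s i).symm

theorem hasCoproduct (F : I → QM.{u}) : HasCoproduct F :=
  have := UQuant.hasCoproduct fun i => (F i).quantale
  let c := Cofan.mk _ (Sigma.ι fun i => (F i).quantale)
  have := QModCat.hasCoproduct fun i => QModCat.extend (c.inj i) (F i).module
  HasColimit.mk ⟨_, isColimitCofan (c := c) (coproductIsCoproduct _) (coproductIsCoproduct
    fun i => QModCat.extend (c.inj i) (F i).module)⟩

end QM

/-- Every family of objects of `QM` has a coproduct, namely `(R, ∐ i, R ⊗_{Q i} M i)`, where `R` is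
the coproduct of the `Q i` in the category of unital quantales and the second component is a
coproduct in the category of `R`-modules; both of these coproducts exist. -/
theorem theorem3p1 {I : Type u} (F : I → QM.{u}) :
    HasCoproduct F ∧
    HasCoproduct (fun i => (F i).quantale) ∧
    ∀ c : Cofan (fun i => (F i).quantale), IsColimit c →
      HasCoproduct (fun i => QModCat.extend (c.inj i) (F i).module) ∧
      ∀ d : Cofan (fun i => QModCat.extend (c.inj i) (F i).module), IsColimit d →
        (∀ i, Function.Injective (QModCat.fn (d.inj i))) ∧
        Nonempty (IsColimit (QM.cofan F c d)) :=
  ⟨QM.hasCoproduct F, UQuant.hasCoproduct _, fun _ hc =>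
    ⟨QModCat.hasCoproduct _, fun _ hd =>
      ⟨QModCat.inj_injective hd, ⟨QM.isColimitCofan hc hd⟩⟩⟩⟩
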